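/- Let $(M,g)$ be a nonempty compact smooth Riemannian manifold without boundary, with volume measure $dV_g$, and let $\Delta_g=-\nabla_i\nabla^i$ be its Laplace–Beltrami operator (with nonnegative spectrum). Let $a\in C^2(M)$ be a positive function whose set of (global) minimum points is a finite set $\{P_1,\dots,P_N\}$, each $P_i$ being a nondegenerate critical point of $a$ in the sense of Morse. For $\varepsilon>0$ set $$\lambda_\varepsilon=\inf_{u\in H_1(M)\setminus\{0\}}\frac{\varepsilon\int_M|\nabla u|_g^2\,dV_g+\int_M a\,u^2\,dV_g}{\int_M u^2\,dV_g},$$ where $H_1(M)$ is the completion of $C^\infty(M)$ for the norm $\|u\|_{L^2}+\|\nabla u\|_{L^2}$. Then: (i) $\lim_{\varepsilon\to0^+}\lambda_\varepsilon=\min_M a$. (ii) For each $\varepsilon>0$ let $u_\varepsilon\in C^2(M)$ be a positive solution of $\varepsilon\Delta_g u_\varepsilon+a\,u_\varepsilon=\lambda_\varepsilon u_\varepsilon$ on $M$. Then each $\mu_\varepsilon=u_\varepsilon^2\,dV_g\big/\int_M u_\varepsilon^2\,dV_g$ is a probability measure, and every limit $\nu$ of the family $(\mu_\varepsilon)$ as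 $\varepsilon\to0^+$, in the weak topology of probability measures on $M$, has the form $$\nu=\sum_{i=1}^N c_i^2\,\delta_{P_i},\qquad c_i\in\mathbb R,\quad \sum_{i=1}^N c_i^2=1,$$ where $\delta_P$ is the Dirac measure at $P$. -/

import Mathlib

open MeasureTheory Filter Topology Bundle
open scoped Manifold ContDiff ENNReal

noncomputable section

namespace RiemannianEigen

/-- A smooth Riemannian metric on a manifold `M` of dimension `n` without boundary. -/
abbrev Metric (n : ℕ) (M : Type*) [TopologicalSpace M]
    [ChartedSpace (EuclideanSpace ℝ (Fin n)) M] [IsManifold (𝓡 n) ∞ M] :=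
  ContMDiffRiemannianMetric (𝓡 n) ∞ (EuclideanSpace ℝ (Fin n))
    (fun x : M => TangentSpace (𝓡 n) x)

variable {n : ℕ} {M : Type*} [TopologicalSpace M]
  [ChartedSpace (EuclideanSpace ℝ (Fin n)) M]

/-- The `i`-th standard basis vector of `ℝⁿ`. -/
def stdVec (i : Fin n) : EuclideanSpace ℝ (Fin n) := EuclideanSpace.single i 1

/-- The coordinate vector field `∂/∂xⁱ` of the chart `e`, at the point of `M` whose
coordinates are `y`. -/
def coordVec (e : OpenPartialHomeomorph M (EuclideanSpace ℝ (Fin n)))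
    (y : EuclideanSpace ℝ (Fin n)) (i : Fin n) : TangentSpace (𝓡 n) (e.symm y) :=
  mfderiv (𝓡 n) (𝓡 n) e.symm y (stdVec i)

/-- The partial derivative `∂f/∂yⁱ` of a real function on `ℝⁿ`. -/
def partialDeriv (i : Fin n) (f : EuclideanSpace ℝ (Fin n) → ℝ)
    (y : EuclideanSpace ℝ (Fin n)) : ℝ :=
  fderiv ℝ f y (stdVec i)

/-- `P` is a nondegenerate critical point of `a`, in the sense of Morse: in the coordinates of the
preferred chart at `P`, the differential of `a` vanishes and its Hessian matrix is invertible. -/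
def IsNondegenerateCriticalPoint (a : M → ℝ) (P : M) : Prop :=
  let f : EuclideanSpace ℝ (Fin n) → ℝ :=
    a ∘ (chartAt (EuclideanSpace ℝ (Fin n)) P).symm
  let y : EuclideanSpace ℝ (Fin n) := chartAt (EuclideanSpace ℝ (Fin n)) P P
  fderiv ℝ f y = 0 ∧
    (Matrix.of fun i j : Fin n => partialDeriv i (partialDeriv j f) y).det ≠ 0

variable [IsManifold (𝓡 n) ∞ M]

/-- The matrix `(g_{ij})` of the metric in the chart `e`, as a function of the coordinates `y`. -/
def metricMatrix (g : Metric n M) (e : OpenPartialHomeomorph M (EuclideanSpace ℝ (Fin n)))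
    (y : EuclideanSpace ℝ (Fin n)) : Matrix (Fin n) (Fin n) ℝ :=
  Matrix.of fun i j => g.inner (e.symm y) (coordVec e y i) (coordVec e y j)

/-- The density `√ det (g_{ij})` in the chart `e`. -/
def volumeDensity (g : Metric n M) (e : OpenPartialHomeomorph M (EuclideanSpace ℝ (Fin n)))
    (y : EuclideanSpace ℝ (Fin n)) : ℝ :=
  Real.sqrt (metricMatrix g e y).det

/-- The measure `√ det (g_{ij}) dy¹ ⋯ dyⁿ` of the chart `e`, carried to the domain of `e` in `M`. -/
def chartVolume [MeasurableSpace M] (g : Metric n M)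
    (e : OpenPartialHomeomorph M (EuclideanSpace ℝ (Fin n))) : Measure M :=
  ((volume.restrict e.target).withDensity
    (fun y => ENNReal.ofReal (volumeDensity g e y))).map e.symm

/-- The Riemannian volume measure `dV_g`. The measures `chartVolume g e` of the charts of the atlas
agree on overlaps, and `dV_g` is the measure that restricts to `chartVolume g e` on the domain of
each chart `e`. When finitely or countably many chart domains cover `M`, this glued measure is the
least measure that dominates all of them, that is, their supremum. -/
def riemannianVolume [MeasurableSpace M] (g : Metric n M) : Measure M :=
  ⨆ e ∈ atlas (EuclideanSpace ℝ (Fin n)) M, chartVolume g e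

/-- The metric at `x`, as a bilinear form on the tangent space. -/
def metricForm (g : Metric n M) (x : M) : LinearMap.BilinForm ℝ (TangentSpace (𝓡 n) x) :=
  LinearMap.mk₂ ℝ (fun v w => g.inner x v w)
    (fun v v' w => by simp) (fun c v w => by simp)
    (fun v w w' => by simp) (fun c v w => by simp)

theorem metricForm_nondegenerate (g : Metric n M) (x : M) :
    (metricForm g x).Nondegenerate := by
  have h : ∀ v : TangentSpace (𝓡 n) x, metricForm g x v v = 0 → v = 0 := by
    intro v hv
    by_contra hne
    exact absurd hv (g.pos x v hne).ne'
  exact ⟨fun v hv => h v (hv v), fun v hv => h v (hv v)⟩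

instance (x : M) : FiniteDimensional ℝ (TangentSpace (𝓡 n) x) :=
  inferInstanceAs (FiniteDimensional ℝ (EuclideanSpace ℝ (Fin n)))

/-- The differential of `u` at `x`, as a linear form on the tangent space. -/
def differential (u : M → ℝ) (x : M) : Module.Dual ℝ (TangentSpace (𝓡 n) x) :=
  (mfderiv (𝓡 n) 𝓘(ℝ, ℝ) u x).toLinearMap

/-- The Riemannian gradient of `u`: the vector field with `g(∇u, w) = du(w)` for all `w`. -/
def gradient (g : Metric n M) (u : M → ℝ) (x : M) : TangentSpace (𝓡 n) x :=
  ((metricForm g x).toDual (metricForm_nondegenerate g x)).symm (differential u x)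

/-- The length `|v|_g` of a tangent vector. -/
def tangentNorm (g : Metric n M) (x : M) (v : TangentSpace (𝓡 n) x) : ℝ :=
  Real.sqrt (g.inner x v v)

/-- `IsH1 g u X`: the function `u` lies in the Sobolev space `H₁(M)`, the completion of
`C^∞(M)` for the norm `‖u‖_{L²} + ‖∇u‖_{L²}`, realised in `L²`, and `X` is its gradient. That is,
some sequence of smooth functions converges to `u` in `L²` while its gradients converge to the
vector field `X` in `L²`. (`MemLp` includes the measurability of the differences, hence that of `u`
and `X` up to null sets.) -/
def IsH1 [MeasurableSpace M] (g : Metric n M) (u : M → ℝ)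
    (X : (x : M) → TangentSpace (𝓡 n) x) : Prop :=
  MemLp u 2 (riemannianVolume g) ∧
  ∃ φ : ℕ → M → ℝ, (∀ k, ContMDiff (𝓡 n) 𝓘(ℝ, ℝ) ∞ (φ k)) ∧
    (∀ k, MemLp (fun x => φ k x - u x) 2 (riemannianVolume g)) ∧
    (∀ k, MemLp (fun x => tangentNorm g x (gradient g (φ k) x - X x)) 2
      (riemannianVolume g)) ∧
    Tendsto (fun k => eLpNorm (fun x => φ k x - u x) 2 (riemannianVolume g))
      atTop (𝓝 0) ∧
    Tendsto (fun k => eLpNorm (fun x => tangentNorm g x (gradient g (φ k) x - X x)) 2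
      (riemannianVolume g)) atTop (𝓝 0)

/-- The Rayleigh quotient `(ε ∫ |X|² + ∫ a u²) / ∫ u²` of a function `u` with gradient `X`. -/
def rayleigh [MeasurableSpace M] (g : Metric n M) (a : M → ℝ) (ε : ℝ) (u : M → ℝ)
    (X : (x : M) → TangentSpace (𝓡 n) x) : ℝ :=
  (ε * ∫ x, tangentNorm g x (X x) ^ 2 ∂(riemannianVolume g)
      + ∫ x, a x * u x ^ 2 ∂(riemannianVolume g))
    / ∫ x, u x ^ 2 ∂(riemannianVolume g)

/-- The first eigenvalue `λ_ε` of `ε Δ_g + a`: the infimum of the Rayleigh quotient over the nonzero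
elements of `H₁(M)`. -/
def firstEigenvalue [MeasurableSpace M] (g : Metric n M) (a : M → ℝ) (ε : ℝ) : ℝ :=
  sInf {r : ℝ | ∃ (u : M → ℝ) (X : (x : M) → TangentSpace (𝓡 n) x),
    IsH1 g u X ∧ ¬ (u =ᵐ[riemannianVolume g] 0) ∧ r = rayleigh g a ε u X}

/-- The Laplacian `Δ_g u = -∇_i ∇^i u` (with nonnegative spectrum) at `x`, computed in the chart `e`:
`- (det g)^{-1/2} ∑_i ∂_i ( (det g)^{1/2} ∑_j g^{ij} ∂_j u )`. -/
def laplacianInChart (g : Metric n M)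
    (e : OpenPartialHomeomorph M (EuclideanSpace ℝ (Fin n))) (u : M → ℝ) (x : M) : ℝ :=
  -((volumeDensity g e (e x))⁻¹ * ∑ i, partialDeriv i
      (fun y => volumeDensity g e y *
        ∑ j, (metricMatrix g e y)⁻¹ i j * partialDeriv j (u ∘ e.symm) y) (e x))

/-- `u` is a positive classical solution of `ε Δ_g u + a u = λ_ε u` on `M`, where `λ_ε` is the first
eigenvalue; the equation is required in all the charts of the atlas. -/
def IsPositiveEigenfunction [MeasurableSpace M] (g : Metric n M) (a : M → ℝ) (ε : ℝ)
    (u : M → ℝ) : Prop :=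
  ContMDiff (𝓡 n) 𝓘(ℝ, ℝ) 2 u ∧ (∀ x, 0 < u x) ∧
    ∀ e ∈ atlas (EuclideanSpace ℝ (Fin n)) M, ∀ x ∈ e.source,
      ε * laplacianInChart g e u x + a x * u x = firstEigenvalue g a ε * u x

/-- The normalized measure `u² dV_g / ∫ u² dV_g`. -/
def normalizedMeasure [MeasurableSpace M] (g : Metric n M) (u : M → ℝ) : Measure M :=
  (∫⁻ x, ENNReal.ofReal (u x ^ 2) ∂(riemannianVolume g))⁻¹ •
    (riemannianVolume g).withDensity (fun x => ENNReal.ofReal (u x ^ 2))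

end RiemannianEigen

end

/-! Write `m` for the minimum of `a`. Every Rayleigh quotient is at least `m`, because the gradient
term is nonnegative. Conversely, a fixed smooth test function supported where `a < b`, for some `b >
m`, has Rayleigh quotient at most `ε * C + b`. Letting `ε → 0` and then `b → m` gives part (i)
(`le_rayleigh`, `exists_firstEigenvalue_le`, `tendsto_firstEigenvalue`).

For part (ii), multiply the equation by `u_ε` and integrate. Green's formula turns `∫ u Δu` into `∫
|∇u|² ≥ 0`, so the mean of `a` under `μ_ε` is at most `λ_ε`; it is also at least `m`. By (i) these
means tend to `m`. Since `a` is continuous on a compact space, its mean is weakly continuous, so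
every limit `ν` satisfies `∫ a dν = m`. The nonnegative function `a - m` then has zero `ν`-integral,
and `ν` is carried by the finite set of minimum points. The `c_i` are the square roots of the masses
(`integral_potential_mul_sq_le`, `exists_eq_sum_dirac`).

Most of the work is Green's formula (`integral_mul_laplacian`). The Laplacian is given in charts and
the volume is a supremum of chart measures. The change of variables formula shows that this supremum
restricts to the expected measure on each chart (`riemannianVolume_restrict_source`). The formula is
then Euclidean integration by parts in one chart, globalized by a partition of unity. -/

namespace RiemannianEigen

/-! ### The metric, its density and gradients in chart coordinates. -/

variable {n : ℕ} {M : Type*} [TopologicalSpace M]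
  [ChartedSpace (EuclideanSpace ℝ (Fin n)) M]

theorem sum_smul_stdVec (w : EuclideanSpace ℝ (Fin n)) : ∑ i, w i • stdVec i = w := by
  ext j
  simp [stdVec, Pi.single_apply]

theorem mfderiv_symm_eq_sum (e : OpenPartialHomeomorph M (EuclideanSpace ℝ (Fin n)))
    (y w : EuclideanSpace ℝ (Fin n)) :
    mfderiv (𝓡 n) (𝓡 n) e.symm y w = ∑ i, w i • coordVec e y i := by
  conv_lhs => rw [← sum_smul_stdVec w]
  erw [map_sum]
  refine Finset.sum_congr rfl fun i _ => ?_
  erw [map_smul]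
  rfl

variable [IsManifold (𝓡 n) ∞ M]

theorem mdifferentiable_chart_of_mem {e : OpenPartialHomeomorph M (EuclideanSpace ℝ (Fin n))}
    (he : e ∈ atlas (EuclideanSpace ℝ (Fin n)) M) : e.MDifferentiable (𝓡 n) (𝓡 n) := by
  have : IsManifold (𝓡 n) 1 M := IsManifold.of_le (n := ∞) (by simp)
  exact mdifferentiable_of_mem_atlas he

/-- In a chart the metric is the pullback of `g` by the differential of `e.symm`, which is
injective, so positivity of `g` passes to the matrix. -/
theorem metricMatrix_posDef (g : Metric n M)
    {e : OpenPartialHomeomorph M (EuclideanSpace ℝ (Fin n))}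
    (he : e ∈ atlas (EuclideanSpace ℝ (Fin n)) M) {y : EuclideanSpace ℝ (Fin n)}
    (hy : y ∈ e.target) : (metricMatrix g e y).PosDef := by
  refine Matrix.PosDef.of_dotProduct_mulVec_pos ?_ ?_
  · ext i j
    simp [metricMatrix, g.symm (e.symm y) (coordVec e y i)]
  · intro x hx
    have hinj := (mdifferentiable_chart_of_mem he).symm.mfderiv_injective (x := y) hy
    have hne : mfderiv (𝓡 n) (𝓡 n) e.symm y (WithLp.toLp 2 x) ≠ 0 := by
      intro h0
      apply hx
      have := hinj (h0.trans (map_zero _).symm)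
      exact congrArg (WithLp.ofLp) this
    have := g.pos (e.symm y) _ hne
    rw [mfderiv_symm_eq_sum] at this
    have hval : g.inner (e.symm y) (∑ i, x i • coordVec e y i) (∑ i, x i • coordVec e y i) =
        ∑ i, ∑ j, x j * (x i * g.inner (e.symm y) (coordVec e y j) (coordVec e y i)) := by
      simp [Finset.mul_sum, mul_left_comm]
    rw [hval, Finset.sum_comm] at this
    simpa [metricMatrix, dotProduct, Matrix.mulVec, Finset.mul_sum, mul_comm, mul_left_comm]
      using this

theorem metricMatrix_det_pos (g : Metric n M)
    {e : OpenPartialHomeomorph M (EuclideanSpace ℝ (Fin n))}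
    (he : e ∈ atlas (EuclideanSpace ℝ (Fin n)) M) {y : EuclideanSpace ℝ (Fin n)}
    (hy : y ∈ e.target) : 0 < (metricMatrix g e y).det :=
  (metricMatrix_posDef g he hy).det_pos

/-- A coordinate field is the tangent map of the smooth `e.symm` applied to a constant field. Class
`C¹` suffices here, since the flux of a `C²` function is differentiated only once. -/
theorem contMDiffOn_coordVec {e : OpenPartialHomeomorph M (EuclideanSpace ℝ (Fin n))}
    (he : e ∈ atlas (EuclideanSpace ℝ (Fin n)) M) (i : Fin n) :
    ContMDiffOn (𝓡 n) (𝓡 n).tangent 1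
      (fun y => (⟨e.symm y, coordVec e y i⟩ : TangentBundle (𝓡 n) M)) e.target := by
  have : IsManifold (𝓡 n) 1 M := IsManifold.of_le (n := ∞) (by simp)
  have h1 : ContMDiffOn (𝓡 n) (𝓡 n) ∞ e.symm e.target :=
    contMDiffOn_symm_of_mem_maximalAtlas (IsManifold.subset_maximalAtlas he)
  have h2 := h1.contMDiffOn_tangentMapWithin (m := 1) (by norm_cast)
    e.open_target.uniqueMDiffOn
  have h3 : ContMDiff (𝓡 n) (𝓡 n).tangent 1
      (fun y => (⟨y, stdVec i⟩ : TangentBundle (𝓡 n) (EuclideanSpace ℝ (Fin n)))) := by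
    exact contMDiff_vectorSpace_iff_contDiff.2 contDiff_const
  refine (h2.comp h3.contMDiffOn (fun y hy => hy)).congr fun y hy => ?_
  simp only [Function.comp, tangentMapWithin, coordVec]
  rw [mfderivWithin_of_isOpen e.open_target hy]

theorem contDiffOn_metricMatrix (g : Metric n M)
    {e : OpenPartialHomeomorph M (EuclideanSpace ℝ (Fin n))}
    (he : e ∈ atlas (EuclideanSpace ℝ (Fin n)) M) (i j : Fin n) :
    ContDiffOn ℝ 1 (fun y => metricMatrix g e y i j) e.target := by
  have h1 : ContMDiffOn (𝓡 n) (𝓡 n) ∞ e.symm e.target :=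
    contMDiffOn_symm_of_mem_maximalAtlas (IsManifold.subset_maximalAtlas he)
  have hg := (g.contMDiff.comp_contMDiffOn h1).of_le (m := 1) (by simp)
  rw [← contMDiffOn_iff_contDiffOn]
  intro y hy
  have := ContMDiffWithinAt.clm_bundle_apply₂ (F₁ := EuclideanSpace ℝ (Fin n))
    (F₂ := EuclideanSpace ℝ (Fin n)) (F₃ := ℝ) (E₃ := Bundle.Trivial M ℝ) (hg y hy)
    (contMDiffOn_coordVec he i y hy) (contMDiffOn_coordVec he j y hy)
  rw [Bundle.contMDiffWithinAt_totalSpace] at this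
  exact this.2

theorem partialDeriv_comp_symm {e : OpenPartialHomeomorph M (EuclideanSpace ℝ (Fin n))}
    (he : e ∈ atlas (EuclideanSpace ℝ (Fin n)) M) {u : M → ℝ} {y : EuclideanSpace ℝ (Fin n)}
    (hy : y ∈ e.target) (hu : MDifferentiableAt (𝓡 n) 𝓘(ℝ, ℝ) u (e.symm y)) (i : Fin n) :
    partialDeriv i (u ∘ e.symm) y = differential u (e.symm y) (coordVec e y i) := by
  rw [partialDeriv, ← mfderiv_eq_fderiv,
    mfderiv_comp y hu ((mdifferentiable_chart_of_mem he).mdifferentiableAt_symm hy)]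
  rfl

theorem inner_gradient (g : Metric n M) (u : M → ℝ) (x : M) (w : TangentSpace (𝓡 n) x) :
    g.inner x (gradient g u x) w = differential u x w :=
  LinearMap.congr_fun
    (((metricForm g x).toDual (metricForm_nondegenerate g x)).apply_symm_apply (differential u x)) w

/-- The coordinates of the gradient in a chart are `g^{ij} ∂_j u`. -/
theorem gradient_eq_sum_coordVec (g : Metric n M)
    {e : OpenPartialHomeomorph M (EuclideanSpace ℝ (Fin n))}
    (he : e ∈ atlas (EuclideanSpace ℝ (Fin n)) M) {u : M → ℝ} {y : EuclideanSpace ℝ (Fin n)}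
    (hy : y ∈ e.target) (hu : MDifferentiableAt (𝓡 n) 𝓘(ℝ, ℝ) u (e.symm y)) :
    gradient g u (e.symm y) =
      ∑ i, (∑ j, (metricMatrix g e y)⁻¹ i j * partialDeriv j (u ∘ e.symm) y) • coordVec e y i := by
  obtain ⟨w, hw⟩ : ∃ w : EuclideanSpace ℝ (Fin n),
      mfderiv (𝓡 n) (𝓡 n) e.symm y w = gradient g u (e.symm y) :=
    (mdifferentiable_chart_of_mem he).symm.mfderiv_surjective (x := y) hy
    (gradient g u (e.symm y))
  have hw' : gradient g u (e.symm y) = ∑ i, w i • coordVec e y i := by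
    rw [← mfderiv_symm_eq_sum]; exact hw.symm
  have hp : ∀ j, partialDeriv j (u ∘ e.symm) y = ∑ k, metricMatrix g e y j k * w k := by
    intro j
    rw [partialDeriv_comp_symm he hy hu, ← inner_gradient g, hw', g.symm]
    simp [metricMatrix, mul_comm]
  have hw2 : (metricMatrix g e y)⁻¹.mulVec ((metricMatrix g e y).mulVec w.ofLp) = w.ofLp := by
    rw [Matrix.mulVec_mulVec, Matrix.nonsing_inv_mul _ (metricMatrix_det_pos g he hy).ne'.isUnit,
      Matrix.one_mulVec]
  rw [hw']
  refine Finset.sum_congr rfl fun i _ => ?_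
  congr 1
  rw [← congrFun hw2 i]
  simp only [hp, Matrix.mulVec, dotProduct]

/-- This is the bilinear expression that integration by parts against the divergence in
`laplacianInChart` produces, up to the factor `volumeDensity`. -/
theorem differential_gradient_eq_sum (g : Metric n M)
    {e : OpenPartialHomeomorph M (EuclideanSpace ℝ (Fin n))}
    (he : e ∈ atlas (EuclideanSpace ℝ (Fin n)) M) {u v : M → ℝ} {y : EuclideanSpace ℝ (Fin n)}
    (hy : y ∈ e.target) (hu : MDifferentiableAt (𝓡 n) 𝓘(ℝ, ℝ) u (e.symm y))
    (hv : MDifferentiableAt (𝓡 n) 𝓘(ℝ, ℝ) v (e.symm y)) :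
    differential v (e.symm y) (gradient g u (e.symm y)) =
      ∑ i, partialDeriv i (v ∘ e.symm) y *
        ∑ j, (metricMatrix g e y)⁻¹ i j * partialDeriv j (u ∘ e.symm) y := by
  rw [gradient_eq_sum_coordVec g he hy hu, map_sum]
  refine Finset.sum_congr rfl fun i _ => ?_
  rw [partialDeriv_comp_symm he hy hv, map_smul, smul_eq_mul, mul_comm]

theorem contDiffOn_volumeDensity (g : Metric n M)
    {e : OpenPartialHomeomorph M (EuclideanSpace ℝ (Fin n))}
    (he : e ∈ atlas (EuclideanSpace ℝ (Fin n)) M) :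
    ContDiffOn ℝ 1 (volumeDensity g e) e.target := by
  refine ContDiffOn.sqrt ?_ fun y hy => (metricMatrix_det_pos g he hy).ne'
  simp only [Matrix.det_apply]
  refine ContDiffOn.sum fun σ _ => ContDiffOn.const_smul _ ?_
  exact contDiffOn_prod fun i _ => contDiffOn_metricMatrix g he _ _

theorem contDiffOn_inv_metricMatrix (g : Metric n M)
    {e : OpenPartialHomeomorph M (EuclideanSpace ℝ (Fin n))}
    (he : e ∈ atlas (EuclideanSpace ℝ (Fin n)) M) (i j : Fin n) :
    ContDiffOn ℝ 1 (fun y => (metricMatrix g e y)⁻¹ i j) e.target := by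
  have hdet : ContDiffOn ℝ 1 (fun y => (metricMatrix g e y).det) e.target := by
    simp only [Matrix.det_apply]
    exact ContDiffOn.sum fun σ _ => ContDiffOn.const_smul _
      (contDiffOn_prod fun i _ => contDiffOn_metricMatrix g he _ _)
  -- By Cramer's rule the inverse is the adjugate over the determinant, both polynomial in the
  -- entries of the matrix.
  have hadj : ContDiffOn ℝ 1 (fun y => (metricMatrix g e y).adjugate i j) e.target := by
    simp only [Matrix.adjugate_apply, Matrix.det_apply]
    refine ContDiffOn.sum fun σ _ => ContDiffOn.const_smul _ (contDiffOn_prod fun k _ => ?_)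
    by_cases h : σ k = j
    · simp only [Matrix.updateRow_apply, h, if_true]
      exact contDiffOn_const
    · simp only [Matrix.updateRow_apply, h, if_false]
      exact contDiffOn_metricMatrix g he _ _
  refine ((hdet.inv fun y hy => (metricMatrix_det_pos g he hy).ne').mul hadj).congr fun y _ => ?_
  simp [Matrix.inv_def]

theorem volumeDensity_pos (g : Metric n M)
    {e : OpenPartialHomeomorph M (EuclideanSpace ℝ (Fin n))}
    (he : e ∈ atlas (EuclideanSpace ℝ (Fin n)) M) {y : EuclideanSpace ℝ (Fin n)}
    (hy : y ∈ e.target) : 0 < volumeDensity g e y :=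
  Real.sqrt_pos.2 (metricMatrix_det_pos g he hy)

end RiemannianEigen

/-! ### Change of charts and the Riemannian volume. -/

namespace RiemannianEigen

theorem measurableSet_target_inter_preimage {n : ℕ} {M : Type*} [TopologicalSpace M]
    [MeasurableSpace M] [BorelSpace M]
    (e : OpenPartialHomeomorph M (EuclideanSpace ℝ (Fin n))) {S : Set M} (hS : MeasurableSet S) :
    MeasurableSet (e.target ∩ e.symm ⁻¹' S) := by
  have h : Measurable (fun y : e.target => e.symm y) :=
    e.continuousOn_symm.domRestrict.measurable
  have := e.open_target.measurableSet.subtype_image (h hS)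
  convert this using 1
  ext y
  simp [and_comm]

/-- Outside `e.target` nothing is known of `e.symm`, so only almost everywhere measurability is
available; it is enough for `Measure.map` not to take its default value `0`. -/
theorem aemeasurable_symm {n : ℕ} {M : Type*} [TopologicalSpace M] [MeasurableSpace M]
    [BorelSpace M] (e : OpenPartialHomeomorph M (EuclideanSpace ℝ (Fin n)))
    (f : EuclideanSpace ℝ (Fin n) → ℝ≥0∞) :
    AEMeasurable e.symm ((volume.restrict e.target).withDensity f) :=
  AEMeasurable.mono_ac
    (e.continuousOn_symm.aemeasurable e.open_target.measurableSet)
    (withDensity_absolutelyContinuous _ _)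

variable {n : ℕ} {M : Type*} [TopologicalSpace M]
  [ChartedSpace (EuclideanSpace ℝ (Fin n)) M] [IsManifold (𝓡 n) ∞ M]

/-- Chain rule for `e.symm = e'.symm ∘ (e' ∘ e.symm)`, valid near `y`. The vectors are compared in
the model space because the two base points are equal only propositionally. -/
theorem mfderiv_symm_eq_comp {e e' : OpenPartialHomeomorph M (EuclideanSpace ℝ (Fin n))}
    (he : e ∈ atlas (EuclideanSpace ℝ (Fin n)) M) (he' : e' ∈ atlas (EuclideanSpace ℝ (Fin n)) M)
    {y : EuclideanSpace ℝ (Fin n)} (hy : y ∈ e.target) (hy' : e.symm y ∈ e'.source) :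
    DifferentiableAt ℝ (e' ∘ e.symm) y ∧ ∀ w : EuclideanSpace ℝ (Fin n),
      (mfderiv (𝓡 n) (𝓡 n) e.symm y w : EuclideanSpace ℝ (Fin n)) =
        mfderiv (𝓡 n) (𝓡 n) e'.symm (e' (e.symm y)) (fderiv ℝ (e' ∘ e.symm) y w) := by
  have hd := mdifferentiable_chart_of_mem he
  have hd' := mdifferentiable_chart_of_mem he'
  have hf : MDifferentiableAt (𝓡 n) (𝓡 n) (e' ∘ e.symm) y :=
    (hd'.mdifferentiableAt hy').comp y (hd.mdifferentiableAt_symm hy)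
  refine ⟨hf.differentiableAt, fun w => ?_⟩
  have hev : e.symm =ᶠ[𝓝 y] e'.symm ∘ (e' ∘ e.symm) := by
    have := (e.continuousAt_symm hy).preimage_mem_nhds (e'.open_source.mem_nhds hy')
    filter_upwards [this] with z hz
    exact (e'.left_inv hz).symm
  have h1 : (mfderiv (𝓡 n) (𝓡 n) e.symm y : EuclideanSpace ℝ (Fin n) →L[ℝ] EuclideanSpace ℝ (Fin n))
      = mfderiv (𝓡 n) (𝓡 n) (e'.symm ∘ (e' ∘ e.symm)) y := hev.mfderiv_eq
  have h2 := mfderiv_comp y (hd'.mdifferentiableAt_symm (e'.map_source hy')) hf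
  rw [← mfderiv_eq_fderiv]
  exact (DFunLike.congr_fun h1 w).trans (DFunLike.congr_fun h2 w)

theorem inner_congr_point (g : Metric n M) {p q : M} (h : p = q) (v w : EuclideanSpace ℝ (Fin n)) :
    (g.inner p v w : ℝ) = g.inner q v w := by
  subst h; rfl

/-- The metric matrix transforms under a change of charts by the Jacobian matrix. -/
theorem metricMatrix_change (g : Metric n M)
    {e e' : OpenPartialHomeomorph M (EuclideanSpace ℝ (Fin n))}
    (he : e ∈ atlas (EuclideanSpace ℝ (Fin n)) M) (he' : e' ∈ atlas (EuclideanSpace ℝ (Fin n)) M)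
    {y : EuclideanSpace ℝ (Fin n)} (hy : y ∈ e.target) (hy' : e.symm y ∈ e'.source) :
    metricMatrix g e y =
      (LinearMap.toMatrix (EuclideanSpace.basisFun (Fin n) ℝ).toBasis
        (EuclideanSpace.basisFun (Fin n) ℝ).toBasis
          (fderiv ℝ (e' ∘ e.symm) y : EuclideanSpace ℝ (Fin n) →ₗ[ℝ] EuclideanSpace ℝ (Fin n))).transpose *
        metricMatrix g e' (e' (e.symm y)) *
      LinearMap.toMatrix (EuclideanSpace.basisFun (Fin n) ℝ).toBasis
        (EuclideanSpace.basisFun (Fin n) ℝ).toBasis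
          (fderiv ℝ (e' ∘ e.symm) y : EuclideanSpace ℝ (Fin n) →ₗ[ℝ] EuclideanSpace ℝ (Fin n)) := by
  ext i j
  have hc : ∀ i, (coordVec e y i : EuclideanSpace ℝ (Fin n)) =
      ∑ k, (fderiv ℝ (e' ∘ e.symm) y (stdVec i)) k • coordVec e' (e' (e.symm y)) k := by
    intro i
    rw [← mfderiv_symm_eq_sum]
    exact (mfderiv_symm_eq_comp he he' hy hy').2 (stdVec i)
  have h1 : metricMatrix g e y i j = g.inner (e'.symm (e' (e.symm y)))
      (∑ k, (fderiv ℝ (e' ∘ e.symm) y (stdVec i)) k • coordVec e' (e' (e.symm y)) k)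
      (∑ k, (fderiv ℝ (e' ∘ e.symm) y (stdVec j)) k • coordVec e' (e' (e.symm y)) k) := by
    rw [← hc i, ← hc j]
    exact inner_congr_point g (e'.left_inv hy').symm _ _
  rw [h1]
  simp only [map_sum, map_smul, Matrix.mul_apply, Matrix.transpose_apply, LinearMap.toMatrix_apply]
  simp [metricMatrix, stdVec, Finset.mul_sum, mul_comm, mul_left_comm]

theorem volumeDensity_change (g : Metric n M)
    {e e' : OpenPartialHomeomorph M (EuclideanSpace ℝ (Fin n))}
    (he : e ∈ atlas (EuclideanSpace ℝ (Fin n)) M) (he' : e' ∈ atlas (EuclideanSpace ℝ (Fin n)) M)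
    {y : EuclideanSpace ℝ (Fin n)} (hy : y ∈ e.target) (hy' : e.symm y ∈ e'.source) :
    volumeDensity g e y =
      |(fderiv ℝ (e' ∘ e.symm) y).det| * volumeDensity g e' (e' (e.symm y)) := by
  rw [volumeDensity, metricMatrix_change g he he' hy hy', Matrix.det_mul, Matrix.det_mul,
    Matrix.det_transpose, LinearMap.det_toMatrix, ← ContinuousLinearMap.det, volumeDensity,
    ← Real.sqrt_sq_eq_abs, ← Real.sqrt_mul (sq_nonneg _)]
  congr 1
  ring

variable [MeasurableSpace M] [BorelSpace M]

theorem chartVolume_apply (g : Metric n M) (e : OpenPartialHomeomorph M (EuclideanSpace ℝ (Fin n)))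
    {S : Set M} (hS : MeasurableSet S) :
    chartVolume g e S =
      ∫⁻ y in e.target ∩ e.symm ⁻¹' S, ENNReal.ofReal (volumeDensity g e y) := by
  rw [chartVolume, Measure.map_apply_of_aemeasurable (aemeasurable_symm e _) hS,
    withDensity_apply', Measure.restrict_restrict' e.open_target.measurableSet, Set.inter_comm]

/-- The Jacobian in the change of variables formula is exactly the factor by which the densities of
the two charts differ. -/
theorem chartVolume_eq_of_subset (g : Metric n M)
    {e e' : OpenPartialHomeomorph M (EuclideanSpace ℝ (Fin n))}
    (he : e ∈ atlas (EuclideanSpace ℝ (Fin n)) M) (he' : e' ∈ atlas (EuclideanSpace ℝ (Fin n)) M)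
    {S : Set M} (hS : MeasurableSet S) (hSe : S ⊆ e.source) (hSe' : S ⊆ e'.source) :
    chartVolume g e' S = chartVolume g e S := by
  have himg : (e' ∘ e.symm) '' (e.target ∩ e.symm ⁻¹' S) = e'.target ∩ e'.symm ⁻¹' S := by
    ext z
    constructor
    · rintro ⟨y, ⟨hy, hyS⟩, rfl⟩
      refine ⟨e'.map_source (hSe' hyS), ?_⟩
      simpa [e'.left_inv (hSe' hyS)] using hyS
    · rintro ⟨hz, hzS⟩
      refine ⟨e (e'.symm z), ⟨e.map_source (hSe hzS), ?_⟩, ?_⟩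
      · simpa [e.left_inv (hSe hzS)] using hzS
      · simp [e.left_inv (hSe hzS), e'.right_inv hz]
  have hinj : Set.InjOn (e' ∘ e.symm) (e.target ∩ e.symm ⁻¹' S) :=
    e'.injOn.comp (e.symm.injOn.mono Set.inter_subset_left) fun y hy => hSe' hy.2
  rw [chartVolume_apply g e' hS, chartVolume_apply g e hS, ← himg,
    lintegral_image_eq_lintegral_abs_det_fderiv_mul volume
      (measurableSet_target_inter_preimage e hS)
      (fun y hy => (mfderiv_symm_eq_comp he he' hy.1 (hSe' hy.2)).1.hasFDerivAt.hasFDerivWithinAt)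
      hinj]
  refine setLIntegral_congr_fun (measurableSet_target_inter_preimage e hS) fun y hy => ?_
  simp only [Function.comp]
  rw [volumeDensity_change g he he' hy.1 (hSe' hy.2), ENNReal.ofReal_mul (abs_nonneg _)]

theorem chartVolume_compl_source (g : Metric n M)
    (e : OpenPartialHomeomorph M (EuclideanSpace ℝ (Fin n))) :
    chartVolume g e e.sourceᶜ = 0 := by
  rw [chartVolume_apply g e e.open_source.measurableSet.compl]
  have : e.target ∩ e.symm ⁻¹' e.sourceᶜ = ∅ := by
    ext y
    simp only [Set.mem_inter_iff, Set.mem_preimage, Set.mem_compl_iff, Set.mem_empty_iff_false,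
      iff_false, not_and, not_not]
    exact fun hy => e.map_target hy
  rw [this, setLIntegral_empty]

/-- The measure of `e'` gives no mass to the complement of `e'.source`, and on the overlap of the
two domains both measures agree. -/
theorem chartVolume_restrict_le (g : Metric n M)
    {e e' : OpenPartialHomeomorph M (EuclideanSpace ℝ (Fin n))}
    (he : e ∈ atlas (EuclideanSpace ℝ (Fin n)) M) (he' : e' ∈ atlas (EuclideanSpace ℝ (Fin n)) M) :
    (chartVolume g e').restrict e.source ≤ chartVolume g e := by
  refine Measure.le_iff.2 fun S hS => ?_
  rw [Measure.restrict_apply hS]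
  have h1 : chartVolume g e' (S ∩ e.source) ≤
      chartVolume g e' (S ∩ e.source ∩ e'.source) + chartVolume g e' (e'.sourceᶜ) := by
    refine (measure_mono ?_).trans (measure_union_le _ _)
    intro x hx
    by_cases h : x ∈ e'.source
    · exact Or.inl ⟨hx, h⟩
    · exact Or.inr h
  refine h1.trans ?_
  rw [chartVolume_compl_source, add_zero, chartVolume_eq_of_subset g he he'
    ((hS.inter e.open_source.measurableSet).inter e'.open_source.measurableSet)
    (fun x hx => hx.1.2) (fun x hx => hx.2)]
  exact measure_mono fun x hx => hx.1.1

/-- This identifies the supremum with the glued measure and reduces every later local computation to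
an integral over `e.target`. -/
theorem riemannianVolume_restrict_source (g : Metric n M)
    {e : OpenPartialHomeomorph M (EuclideanSpace ℝ (Fin n))}
    (he : e ∈ atlas (EuclideanSpace ℝ (Fin n)) M) :
    (riemannianVolume g).restrict e.source = chartVolume g e := by
  have hm := e.open_source.measurableSet
  apply le_antisymm
  -- To bound a supremum of measures it suffices to dominate each `chartVolume g e'`: split it into
  -- its part on `e.source` and its part on the complement.
  · have hle : riemannianVolume g ≤
        chartVolume g e + (riemannianVolume g).restrict e.sourceᶜ := by
      refine iSup₂_le fun e' he' => ?_
      rw [← Measure.restrict_add_restrict_compl (μ := chartVolume g e') hm]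
      refine add_le_add (chartVolume_restrict_le g he he') (Measure.restrict_mono le_rfl ?_)
      exact le_iSup₂ (f := fun e _ => chartVolume g e) e' he'
    refine (Measure.restrict_mono le_rfl hle).trans ?_
    rw [Measure.restrict_add, Measure.restrict_restrict hm, Set.inter_compl_self,
      Measure.restrict_empty, add_zero]
    exact Measure.restrict_le_self
  · have h1 : chartVolume g e = (chartVolume g e).restrict e.source := by
      conv_lhs => rw [← Measure.restrict_add_restrict_compl (μ := chartVolume g e) hm]
      rw [Measure.restrict_eq_zero.2 (chartVolume_compl_source g e), add_zero]
    rw [h1]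
    exact Measure.restrict_mono le_rfl (le_iSup₂ (f := fun e _ => chartVolume g e) e he)

theorem riemannianVolume_apply_of_subset (g : Metric n M)
    {e : OpenPartialHomeomorph M (EuclideanSpace ℝ (Fin n))}
    (he : e ∈ atlas (EuclideanSpace ℝ (Fin n)) M) {S : Set M} (hS : MeasurableSet S)
    (hSe : S ⊆ e.source) :
    riemannianVolume g S =
      ∫⁻ y in e.target ∩ e.symm ⁻¹' S, ENNReal.ofReal (volumeDensity g e y) := by
  rw [← chartVolume_apply g e hS, ← riemannianVolume_restrict_source g he,
    Measure.restrict_apply hS, Set.inter_eq_left.2 hSe]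

instance isLocallyFiniteMeasure_riemannianVolume (g : Metric n M) :
    IsLocallyFiniteMeasure (riemannianVolume g) := by
  refine ⟨fun x => ?_⟩
  set e := chartAt (EuclideanSpace ℝ (Fin n)) x with he
  have hea : e ∈ atlas (EuclideanSpace ℝ (Fin n)) M := chart_mem_atlas _ x
  have hxs : x ∈ e.source := mem_chart_source _ x
  have hcont : ContinuousOn (volumeDensity g e) e.target :=
    (contDiffOn_volumeDensity g hea).continuousOn
  obtain ⟨r, hr, hball⟩ := Metric.nhds_basis_closedBall.mem_iff.1
    (e.open_target.mem_nhds (e.map_source hxs))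
  have hKi : IntegrableOn (volumeDensity g e) (Metric.closedBall (e x) r) :=
    (hcont.mono hball).integrableOn_compact (isCompact_closedBall _ _)
  refine ⟨e.source ∩ e ⁻¹' Metric.ball (e x) r, ?_, ?_⟩
  · exact (e.isOpen_inter_preimage Metric.isOpen_ball).mem_nhds ⟨hxs, Metric.mem_ball_self hr⟩
  · rw [riemannianVolume_apply_of_subset g hea
      (e.isOpen_inter_preimage Metric.isOpen_ball).measurableSet Set.inter_subset_left]
    refine (lintegral_mono_set (t := Metric.closedBall (e x) r) ?_).trans_lt ?_
    · rintro y ⟨hy, hy2⟩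
      have := hy2.2
      simp only [Set.mem_preimage, e.right_inv hy] at this
      exact Metric.ball_subset_closedBall this
    · exact hKi.lintegral_lt_top

/-- The density is strictly positive, so a null open set would have a Lebesgue-null, nonempty open
image in a chart. -/
theorem isOpenPosMeasure_riemannianVolume (g : Metric n M) :
    (riemannianVolume g).IsOpenPosMeasure := by
  refine ⟨fun U hU ⟨x, hx⟩ h0 => ?_⟩
  set e := chartAt (EuclideanSpace ℝ (Fin n)) x with he
  have hea : e ∈ atlas (EuclideanSpace ℝ (Fin n)) M := chart_mem_atlas _ x
  have hxs : x ∈ e.source := mem_chart_source _ x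
  have hV : IsOpen (e.target ∩ e.symm ⁻¹' (U ∩ e.source)) :=
    e.symm.isOpen_inter_preimage (hU.inter e.open_source)
  have h1 : riemannianVolume g (U ∩ e.source) = 0 := measure_mono_null Set.inter_subset_left h0
  rw [riemannianVolume_apply_of_subset g hea (hU.inter e.open_source).measurableSet
    Set.inter_subset_right] at h1
  have hpos : 0 < volume (e.target ∩ e.symm ⁻¹' (U ∩ e.source)) :=
    hV.measure_pos _ ⟨e x, e.map_source hxs, by simp [e.left_inv hxs, hx, hxs]⟩
  have hcont : ContinuousOn (volumeDensity g e) (e.target ∩ e.symm ⁻¹' (U ∩ e.source)) :=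
    (contDiffOn_volumeDensity g hea).continuousOn.mono Set.inter_subset_left
  rw [lintegral_eq_zero_iff' (hcont.aemeasurable hV.measurableSet).ennreal_ofReal] at h1
  have h2 := (ae_restrict_iff' hV.measurableSet).1 h1
  refine hpos.ne' (measure_mono_null (fun y hy => ?_) h2)
  intro h
  have := h hy
  simp only [Pi.zero_apply, ENNReal.ofReal_eq_zero] at this
  exact absurd (volumeDensity_pos g hea hy.1) this.not_gt

theorem chartVolume_integral (g : Metric n M)
    {e : OpenPartialHomeomorph M (EuclideanSpace ℝ (Fin n))}
    (he : e ∈ atlas (EuclideanSpace ℝ (Fin n)) M) {f : M → ℝ} (hf : ContinuousOn f e.source)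
    (hfe : ∀ x ∉ e.source, f x = 0) :
    ∫ x, f x ∂(riemannianVolume g) =
      ∫ y in e.target, volumeDensity g e y * f (e.symm y) := by
  have hm := e.open_source.measurableSet
  have hmeas : AEStronglyMeasurable f (chartVolume g e) := by
    rw [← riemannianVolume_restrict_source g he]
    exact (hf.aemeasurable hm).aestronglyMeasurable
  rw [← setIntegral_eq_integral_of_forall_compl_eq_zero hfe,
    riemannianVolume_restrict_source g he, chartVolume,
    integral_map (aemeasurable_symm e _) hmeas]
  have hvd : AEMeasurable (volumeDensity g e) (volume.restrict e.target) :=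
    (contDiffOn_volumeDensity g he).continuousOn.aemeasurable e.open_target.measurableSet
  rw [integral_withDensity_eq_integral_toReal_smul₀ hvd.ennreal_ofReal (by simp)]
  refine setIntegral_congr_fun e.open_target.measurableSet fun y hy => ?_
  simp [ENNReal.toReal_ofReal (volumeDensity_pos g he hy).le]

end RiemannianEigen

/-! ### Integration by parts in a single chart. -/

namespace RiemannianEigen

theorem integrable_mul_of_support_subset_compact {E : Type*} [NormedAddCommGroup E]
    [MeasurableSpace E] [BorelSpace E] (μ : Measure E) [IsFiniteMeasureOnCompacts μ]
    {K : Set E} (hK : IsCompact K) {f h : E → ℝ} (hf : Continuous f)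
    (hfK : Function.support f ⊆ K) (hh : ContinuousOn h K) :
    Integrable (fun y => f y * h y) μ := by
  have h1 : IntegrableOn (fun y => f y * h y) K μ :=
    (hf.continuousOn.mul hh).integrableOn_compact hK
  refine (integrableOn_iff_integrable_of_support_subset ?_).1 h1
  exact (Function.support_mul_subset_left f h).trans hfK

/-- Integration by parts against a compactly supported function, for a function which is only
differentiable on an open set containing the support. -/
theorem integral_mul_partialDeriv {n : ℕ} {U : Set (EuclideanSpace ℝ (Fin n))} (hU : IsOpen U)
    {ψ F : EuclideanSpace ℝ (Fin n) → ℝ} (hψ : ContDiff ℝ 1 ψ) (hψc : HasCompactSupport ψ)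
    (hψU : tsupport ψ ⊆ U) (hF : ContDiffOn ℝ 1 F U) (i : Fin n) :
    Integrable (fun y => ψ y * partialDeriv i F y) ∧
    Integrable (fun y => partialDeriv i ψ y * F y) ∧
    ∫ y, ψ y * partialDeriv i F y = -∫ y, partialDeriv i ψ y * F y := by
  have hF' : ContinuousOn (partialDeriv i F) U :=
    (hF.continuousOn_fderiv_of_isOpen hU le_rfl).clm_apply continuousOn_const
  have hψ' : Continuous (partialDeriv i ψ) :=
    (hψ.continuous_fderiv one_ne_zero).clm_apply continuous_const
  have hs : Function.support (partialDeriv i ψ) ⊆ tsupport ψ := by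
    intro y hy
    apply support_fderiv_subset ℝ (f := ψ)
    intro h0
    apply hy
    simp [partialDeriv, h0]
  have i1 := integrable_mul_of_support_subset_compact volume hψc hψ.continuous
    (subset_tsupport ψ) (hF'.mono hψU)
  have i2 := integrable_mul_of_support_subset_compact volume hψc hψ' hs
    (hF.continuousOn.mono hψU)
  have i3 := integrable_mul_of_support_subset_compact volume hψc hψ.continuous
    (subset_tsupport ψ) (hF.continuousOn.mono hψU)
  refine ⟨i1, i2, integral_mul_fderiv_eq_neg_fderiv_mul_of_integrable i2 i1 i3
    (fun y _ => (hψ.differentiable one_ne_zero) y) fun y hy => ?_⟩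
  exact (hF.differentiableOn one_ne_zero).differentiableAt (hU.mem_nhds (hψU hy))

theorem differential_eq_zero_of_notMem_tsupport {n : ℕ} {M : Type*} [TopologicalSpace M]
    [ChartedSpace (EuclideanSpace ℝ (Fin n)) M] {χ : M → ℝ} {x : M} (hx : x ∉ tsupport χ) :
    differential (n := n) χ x = 0 := by
  have h : χ =ᶠ[𝓝 x] fun _ => (0 : ℝ) := notMem_tsupport_iff_eventuallyEq.1 hx
  have h1 : mfderiv (𝓡 n) 𝓘(ℝ, ℝ) χ x = 0 := h.mfderiv_eq.trans mfderiv_const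
  rw [differential, h1]
  rfl

variable {n : ℕ} {M : Type*} [TopologicalSpace M]
  [ChartedSpace (EuclideanSpace ℝ (Fin n)) M] [IsManifold (𝓡 n) ∞ M]

theorem contDiffOn_comp_symm {e : OpenPartialHomeomorph M (EuclideanSpace ℝ (Fin n))}
    (he : e ∈ atlas (EuclideanSpace ℝ (Fin n)) M) {u : M → ℝ} {k : ℕ∞}
    (hu : ContMDiff (𝓡 n) 𝓘(ℝ, ℝ) k u) : ContDiffOn ℝ k (u ∘ e.symm) e.target := by
  have h1 : ContMDiffOn (𝓡 n) (𝓡 n) ∞ e.symm e.target :=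
    contMDiffOn_symm_of_mem_maximalAtlas (IsManifold.subset_maximalAtlas he)
  exact (hu.comp_contMDiffOn (h1.of_le (by exact_mod_cast le_top))).contDiffOn

/-- The `i`-th component of the field `√det g · ∇u` in the chart `e`. -/
noncomputable def fluxComponent (g : Metric n M)
    (e : OpenPartialHomeomorph M (EuclideanSpace ℝ (Fin n)))
    (u : M → ℝ) (i : Fin n) (y : EuclideanSpace ℝ (Fin n)) : ℝ :=
  volumeDensity g e y * ∑ j, (metricMatrix g e y)⁻¹ i j * partialDeriv j (u ∘ e.symm) y

theorem contDiffOn_fluxComponent (g : Metric n M)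
    {e : OpenPartialHomeomorph M (EuclideanSpace ℝ (Fin n))}
    (he : e ∈ atlas (EuclideanSpace ℝ (Fin n)) M) {u : M → ℝ}
    (hu : ContMDiff (𝓡 n) 𝓘(ℝ, ℝ) 2 u) (i : Fin n) :
    ContDiffOn ℝ 1 (fluxComponent g e u i) e.target := by
  refine (contDiffOn_volumeDensity g he).mul (ContDiffOn.sum fun j _ =>
    (contDiffOn_inv_metricMatrix g he i j).mul ?_)
  exact ((contDiffOn_comp_symm (k := 2) he hu).fderiv_of_isOpen e.open_target
    (by norm_num [one_add_one_eq_two])).clm_apply contDiffOn_const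

/-- The image of the support is compact inside `e.target`, so extension by zero creates no
singularity at the boundary of the target. This provides the globally defined test function needed
for Euclidean integration by parts. -/
theorem contDiff_indicator_comp_symm [CompactSpace M]
    {e : OpenPartialHomeomorph M (EuclideanSpace ℝ (Fin n))}
    (he : e ∈ atlas (EuclideanSpace ℝ (Fin n)) M) {χ : M → ℝ}
    (hχ : ContMDiff (𝓡 n) 𝓘(ℝ, ℝ) 1 χ) (hsupp : tsupport χ ⊆ e.source) :
    ContDiff ℝ 1 (e.target.indicator (χ ∘ e.symm)) ∧
    HasCompactSupport (e.target.indicator (χ ∘ e.symm)) ∧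
    tsupport (e.target.indicator (χ ∘ e.symm)) ⊆ e.target := by
  set ψ := e.target.indicator (χ ∘ e.symm) with hψdef
  have hK : IsCompact (e '' tsupport χ) :=
    (isClosed_tsupport χ).isCompact.image_of_continuousOn (e.continuousOn.mono hsupp)
  have hKt : e '' tsupport χ ⊆ e.target := by
    rintro _ ⟨x, hx, rfl⟩
    exact e.map_source (hsupp hx)
  have hzero : ∀ y ∉ e '' tsupport χ, ψ y = 0 := by
    intro y hy
    by_cases hyt : y ∈ e.target
    · rw [hψdef, Set.indicator_of_mem hyt]
      by_contra h
      exact hy ⟨e.symm y, subset_tsupport χ h, e.right_inv hyt⟩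
    · exact Set.indicator_of_notMem hyt _
  have hts : tsupport ψ ⊆ e '' tsupport χ := by
    refine closure_minimal (fun y hy => ?_) hK.isClosed
    by_contra h
    exact hy (hzero y h)
  refine ⟨?_, HasCompactSupport.intro hK hzero, hts.trans hKt⟩
  rw [contDiff_iff_contDiffAt]
  intro y
  by_cases hy : y ∈ e.target
  · refine ((contDiffOn_comp_symm (k := 1) he hχ).contDiffAt
      (e.open_target.mem_nhds hy)).congr_of_eventuallyEq ?_
    filter_upwards [e.open_target.mem_nhds hy] with z hz
    exact Set.indicator_of_mem hz _
  · have hy' : y ∉ e '' tsupport χ := fun h => hy (hKt h)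
    refine (contDiffAt_const (c := (0 : ℝ))).congr_of_eventuallyEq ?_
    filter_upwards [hK.isClosed.isOpen_compl.mem_nhds hy'] with z hz
    exact hzero z hz

theorem continuous_differential_gradient (g : Metric n M) {u χ : M → ℝ}
    (hu : ContMDiff (𝓡 n) 𝓘(ℝ, ℝ) 2 u) (hχ : ContMDiff (𝓡 n) 𝓘(ℝ, ℝ) 1 χ) :
    Continuous fun x => differential χ x (gradient g u x) := by
  rw [continuous_iff_continuousAt]
  intro x
  set e := chartAt (EuclideanSpace ℝ (Fin n)) x
  have he : e ∈ atlas (EuclideanSpace ℝ (Fin n)) M := chart_mem_atlas _ x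
  have hud : MDifferentiable (𝓡 n) 𝓘(ℝ, ℝ) u := hu.mdifferentiable two_ne_zero
  have hχd : MDifferentiable (𝓡 n) 𝓘(ℝ, ℝ) χ := hχ.mdifferentiable one_ne_zero
  have hc : ContinuousOn (fun y => ∑ i, partialDeriv i (χ ∘ e.symm) y *
        ∑ j, (metricMatrix g e y)⁻¹ i j * partialDeriv j (u ∘ e.symm) y) e.target := by
    refine continuousOn_finsetSum _ fun i _ => ContinuousOn.mul ?_ <|
      continuousOn_finsetSum _ fun j _ =>
        (contDiffOn_inv_metricMatrix g he i j).continuousOn.mul ?_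
    · exact ((contDiffOn_comp_symm (k := 1) he hχ).continuousOn_fderiv_of_isOpen e.open_target
        le_rfl).clm_apply continuousOn_const
    · exact ((contDiffOn_comp_symm (k := 2) he hu).continuousOn_fderiv_of_isOpen e.open_target
        (by norm_num)).clm_apply continuousOn_const
  have h2 := hc.comp e.continuousOn e.mapsTo
  refine (h2.congr fun z hz => ?_).continuousAt
    (e.open_source.mem_nhds (mem_chart_source _ x))
  have := differential_gradient_eq_sum g he (e.map_source hz) (hud _) (hχd _)
  rw [e.left_inv hz] at this
  exact this

variable [MeasurableSpace M] [BorelSpace M] [CompactSpace M]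

/-- Green's formula for a function supported in the domain of a chart. -/
theorem integral_mul_laplacianInChart (g : Metric n M)
    {e : OpenPartialHomeomorph M (EuclideanSpace ℝ (Fin n))}
    (he : e ∈ atlas (EuclideanSpace ℝ (Fin n)) M) {u χ : M → ℝ}
    (hu : ContMDiff (𝓡 n) 𝓘(ℝ, ℝ) 2 u) (hχ : ContMDiff (𝓡 n) 𝓘(ℝ, ℝ) 1 χ)
    (hsupp : tsupport χ ⊆ e.source) :
    ∫ x, χ x * laplacianInChart g e u x ∂(riemannianVolume g) =
      ∫ x, differential χ x (gradient g u x) ∂(riemannianVolume g) := by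
  have hud : MDifferentiable (𝓡 n) 𝓘(ℝ, ℝ) u := hu.mdifferentiable two_ne_zero
  have hχd : MDifferentiable (𝓡 n) 𝓘(ℝ, ℝ) χ := hχ.mdifferentiable one_ne_zero
  obtain ⟨hψ, hψc, hψt⟩ := contDiff_indicator_comp_symm he hχ hsupp
  set ψ := e.target.indicator (χ ∘ e.symm) with hψdef
  have hF := contDiffOn_fluxComponent g he hu
  have hparts := fun i => integral_mul_partialDeriv e.open_target hψ hψc hψt (hF i) i
  have hlap : ContinuousOn (laplacianInChart g e u) e.source := by
    have h1 : ContinuousOn (fun y => -((volumeDensity g e y)⁻¹ *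
        ∑ i, partialDeriv i (fluxComponent g e u i) y)) e.target := by
      refine (((contDiffOn_volumeDensity g he).continuousOn.inv₀
        fun y hy => (volumeDensity_pos g he hy).ne').mul
          (continuousOn_finsetSum _ fun i _ => ?_)).neg
      exact ((hF i).continuousOn_fderiv_of_isOpen e.open_target le_rfl).clm_apply
        continuousOn_const
    exact h1.comp e.continuousOn e.mapsTo
  have hψ0 : ∀ y ∉ e.target, ψ y = 0 := fun y hy => Set.indicator_of_notMem hy _
  have hψ0' : ∀ i, ∀ y ∉ e.target, partialDeriv i ψ y = 0 := by
    intro i y hy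
    have h : y ∉ tsupport ψ := fun h => hy (hψt h)
    have : ψ =ᶠ[𝓝 y] fun _ => (0 : ℝ) := notMem_tsupport_iff_eventuallyEq.1 h
    simp [partialDeriv, this.fderiv_eq]
  rw [chartVolume_integral g he (f := fun x => χ x * laplacianInChart g e u x)
      (hχ.continuous.continuousOn.mul hlap)
      fun x hx => by simp [image_eq_zero_of_notMem_tsupport fun h => hx (hsupp h)],
    chartVolume_integral g he (continuous_differential_gradient g hu hχ).continuousOn
      fun x hx => by simp [differential_eq_zero_of_notMem_tsupport (n := n) fun h => hx (hsupp h)]]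
  calc ∫ y in e.target, volumeDensity g e y * (χ (e.symm y) * laplacianInChart g e u (e.symm y))
      = ∫ y in e.target, -∑ i, ψ y * partialDeriv i (fluxComponent g e u i) y := by
        -- The factor `volumeDensity⁻¹` in the Laplacian cancels the density of the volume, leaving
        -- a Euclidean divergence.
        refine setIntegral_congr_fun e.open_target.measurableSet fun y hy => ?_
        have hv := (volumeDensity_pos g he hy).ne'
        simp only [laplacianInChart, e.right_inv hy, hψdef, Set.indicator_of_mem hy,
          Function.comp, ← Finset.mul_sum]
        change volumeDensity g e y * (χ (e.symm y) * -((volumeDensity g e y)⁻¹ *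
          ∑ i, partialDeriv i (fluxComponent g e u i) y)) = _
        field_simp
    _ = ∫ y, -∑ i, ψ y * partialDeriv i (fluxComponent g e u i) y :=
        setIntegral_eq_integral_of_forall_compl_eq_zero fun y hy => by simp [hψ0 y hy]
    _ = ∫ y, ∑ i, partialDeriv i ψ y * fluxComponent g e u i y := by
        rw [integral_neg, integral_finsetSum _ fun i _ => (hparts i).1,
          integral_finsetSum _ fun i _ => (hparts i).2.1, ← Finset.sum_neg_distrib]
        exact Finset.sum_congr rfl fun i _ => by rw [(hparts i).2.2, neg_neg]
    _ = ∫ y in e.target, ∑ i, partialDeriv i ψ y * fluxComponent g e u i y :=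
        (setIntegral_eq_integral_of_forall_compl_eq_zero fun y hy => by
          simp [hψ0' _ y hy]).symm
    _ = _ := by
        refine setIntegral_congr_fun e.open_target.measurableSet fun y hy => ?_
        have hev : ψ =ᶠ[𝓝 y] χ ∘ e.symm := by
          filter_upwards [e.open_target.mem_nhds hy] with z hz
          exact Set.indicator_of_mem hz _
        simp only [differential_gradient_eq_sum g he hy (hud _) (hχd _), fluxComponent]
        rw [Finset.mul_sum]
        refine Finset.sum_congr rfl fun i _ => ?_
        rw [partialDeriv, hev.fderiv_eq]
        simp only [partialDeriv]
        ring

end RiemannianEigen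

/-! ### Green's formula on the whole manifold and the energy inequality. -/

namespace RiemannianEigen

theorem differential_finset_sum {n : ℕ} {M : Type*} [TopologicalSpace M]
    [ChartedSpace (EuclideanSpace ℝ (Fin n)) M] {ι : Type*} (s : Finset ι) {f : ι → M → ℝ} {x : M}
    (hf : ∀ i ∈ s, MDifferentiableAt (𝓡 n) 𝓘(ℝ, ℝ) (f i) x) :
    differential (n := n) (fun z => ∑ i ∈ s, f i z) x = ∑ i ∈ s, differential (n := n) (f i) x := by
  have hadd : ∀ f' : ι → TangentSpace (𝓡 n) x →L[ℝ] ℝ,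
      (∀ i ∈ s, HasMFDerivAt (𝓡 n) 𝓘(ℝ, ℝ) (f i) x (f' i)) →
      HasMFDerivAt (𝓡 n) 𝓘(ℝ, ℝ) (∑ i ∈ s, f i) x (∑ i ∈ s, f' i : _ →L[ℝ] ℝ) := by
    intro f' h'
    clear hf
    classical
    induction s using Finset.induction_on with
    | empty => exact hasMFDerivAt_const (I := 𝓡 n) (I' := 𝓘(ℝ, ℝ)) (0 : ℝ) x
    | insert i s hi ih =>
      have := (h' i (Finset.mem_insert_self i s)).add
        (ih fun j hj => h' j (Finset.mem_insert_of_mem hj))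
      have e1 : ∑ j ∈ insert i s, f' j = f' i + ∑ j ∈ s, f' j := Finset.sum_insert hi
      rw [Finset.sum_insert hi, e1]
      exact this
  have h := hadd (fun i => mfderiv (𝓡 n) 𝓘(ℝ, ℝ) (f i) x) fun i hi => (hf i hi).hasMFDerivAt
  have h1 : (fun z => ∑ i ∈ s, f i z) = ∑ i ∈ s, f i := by ext; simp
  rw [h1, differential, h.mfderiv]
  exact ContinuousLinearMap.toLinearMap_sum _ _

/-- The quantity is `|∇u|²`; its sign is all that the energy inequality takes from the right side of
Green's formula. -/
theorem differential_gradient_self_nonneg {n : ℕ} {M : Type*} [TopologicalSpace M]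
    [ChartedSpace (EuclideanSpace ℝ (Fin n)) M] [IsManifold (𝓡 n) ∞ M] (g : Metric n M)
    (u : M → ℝ) (x : M) : 0 ≤ differential u x (gradient g u x) := by
  rw [← inner_gradient]
  rcases eq_or_ne (gradient g u x) 0 with h | h
  · simp [h]
  · exact (g.pos x _ h).le

variable {n : ℕ} {M : Type*} [TopologicalSpace M]
  [ChartedSpace (EuclideanSpace ℝ (Fin n)) M] [IsManifold (𝓡 n) ∞ M]
  [MeasurableSpace M] [BorelSpace M] [CompactSpace M]

theorem integrable_riemannianVolume (g : Metric n M) {f : M → ℝ} (hf : Continuous f) :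
    Integrable f (riemannianVolume g) :=
  hf.integrable_of_hasCompactSupport (HasCompactSupport.of_compactSpace f)

/-- **Green's formula** on a compact manifold without boundary. -/
theorem integral_mul_laplacian [T2Space M] (g : Metric n M) {u h : M → ℝ}
    (hu : ContMDiff (𝓡 n) 𝓘(ℝ, ℝ) 2 u) (hh : Continuous h)
    (hlap : ∀ e ∈ atlas (EuclideanSpace ℝ (Fin n)) M, ∀ x ∈ e.source,
      laplacianInChart g e u x = h x) :
    ∫ x, u x * h x ∂(riemannianVolume g) =
      ∫ x, differential u x (gradient g u x) ∂(riemannianVolume g) := by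
  have hu1 : ContMDiff (𝓡 n) 𝓘(ℝ, ℝ) 1 u := hu.of_le one_le_two
  obtain ⟨t, ht⟩ := CompactSpace.elim_nhds_subcover
    (fun x : M => (chartAt (EuclideanSpace ℝ (Fin n)) x).source)
    fun x => chart_source_mem_nhds _ x
  obtain ⟨ρ, hρ⟩ := SmoothPartitionOfUnity.exists_isSubordinate (𝓡 n) (isClosed_univ (X := M))
    (fun i : t => (chartAt (EuclideanSpace ℝ (Fin n)) (i : M)).source)
    (fun i => (chartAt _ (i : M)).open_source)
    (fun x _ => by
      have hx : x ∈ ⋃ x ∈ t, (chartAt (EuclideanSpace ℝ (Fin n)) x).source := ht ▸ trivial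
      simpa using hx)
  have hsum : ∀ x, ∑ i, ρ i x = 1 := fun x => by
    rw [← finsum_eq_sum_of_fintype]; exact ρ.sum_eq_one (Set.mem_univ x)
  have hρ1 : ∀ i, ContMDiff (𝓡 n) 𝓘(ℝ, ℝ) 1 (fun x => ρ i x * u x) := fun i =>
    ((ρ i).contMDiff.of_le (by simp)).mul hu1
  -- Only the test factor is localized; the Laplacian and the gradient remain those of `u`. Thus no
  -- product rule is needed, and the pieces recombine by linearity of the differential.
  have hρu : u = fun x => ∑ i, ρ i x * u x := by
    ext x; rw [← Finset.sum_mul, hsum, one_mul]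
  have hpiece : ∀ i, ∫ x, ρ i x * u x * h x ∂(riemannianVolume g) =
      ∫ x, differential (fun x => ρ i x * u x) x (gradient g u x) ∂(riemannianVolume g) := by
    intro i
    have hs : tsupport (fun x => ρ i x * u x) ⊆ (chartAt _ (i : M)).source :=
      (tsupport_mul_subset_left).trans (hρ i)
    rw [← integral_mul_laplacianInChart g (chart_mem_atlas _ (i : M)) hu (hρ1 i) hs]
    refine integral_congr_ae (Eventually.of_forall fun x => ?_)
    by_cases hx : x ∈ (chartAt (EuclideanSpace ℝ (Fin n)) (i : M)).source
    · simp only [hlap _ (chart_mem_atlas _ (i : M)) x hx]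
    · have : ρ i x * u x = 0 :=
        image_eq_zero_of_notMem_tsupport (f := fun x => ρ i x * u x) fun h => hx (hs h)
      simp only [this, zero_mul]
  calc ∫ x, u x * h x ∂(riemannianVolume g)
      = ∫ x, ∑ i, ρ i x * u x * h x ∂(riemannianVolume g) := by
        simp only [← Finset.sum_mul, hsum, one_mul]
    _ = ∑ i, ∫ x, differential (fun x => ρ i x * u x) x (gradient g u x)
          ∂(riemannianVolume g) := by
        rw [integral_finsetSum _ fun i _ => integrable_riemannianVolume g
          (f := fun x => ρ i x * u x * h x) ((hρ1 i).continuous.mul hh)]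
        exact Finset.sum_congr rfl fun i _ => hpiece i
    _ = ∫ x, ∑ i, differential (fun x => ρ i x * u x) x (gradient g u x)
          ∂(riemannianVolume g) :=
        (integral_finsetSum _ fun i _ => integrable_riemannianVolume g
          (continuous_differential_gradient g hu (hρ1 i))).symm
    _ = _ := by
        refine integral_congr_ae (Eventually.of_forall fun x => ?_)
        have := differential_finset_sum Finset.univ (f := fun i x => ρ i x * u x) (x := x)
          fun i _ => (hρ1 i).mdifferentiable one_ne_zero x
        rw [← hρu] at this
        simp only [this, LinearMap.sum_apply]

/-- The energy of a solution of `ε Δ u + a u = Λ u` gives `∫ a u² ≤ Λ ∫ u²`. -/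
theorem integral_potential_mul_sq_le [T2Space M] (g : Metric n M) {a : M → ℝ} (ha : Continuous a)
    {ε Λ : ℝ} (hε : 0 < ε) {u : M → ℝ} (hu : ContMDiff (𝓡 n) 𝓘(ℝ, ℝ) 2 u)
    (heq : ∀ e ∈ atlas (EuclideanSpace ℝ (Fin n)) M, ∀ x ∈ e.source,
      ε * laplacianInChart g e u x + a x * u x = Λ * u x) :
    ∫ x, a x * u x ^ 2 ∂(riemannianVolume g) ≤ Λ * ∫ x, u x ^ 2 ∂(riemannianVolume g) := by
  have huc := hu.continuous
  -- Solving the equation for `Δu` gives one continuous function on `M`, the same in all charts.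
  have hh : Continuous fun x => (Λ - a x) * u x / ε := by fun_prop
  have hgreen := integral_mul_laplacian g hu hh fun e he x hx => by
    have := heq e he x hx
    field_simp
    linarith
  have h0 : 0 ≤ ∫ x, u x * ((Λ - a x) * u x / ε) ∂(riemannianVolume g) := by
    rw [hgreen]
    exact integral_nonneg fun x => differential_gradient_self_nonneg g u x
  have h1 : ∫ x, u x * ((Λ - a x) * u x / ε) ∂(riemannianVolume g) =
      (Λ * ∫ x, u x ^ 2 ∂(riemannianVolume g) -
        ∫ x, a x * u x ^ 2 ∂(riemannianVolume g)) / ε := by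
    rw [← integral_const_mul, ← integral_sub (integrable_riemannianVolume g (by fun_prop))
      (integrable_riemannianVolume g (by fun_prop)), ← integral_div]
    refine integral_congr_ae (Eventually.of_forall fun x => ?_)
    ring
  rw [h1, le_div_iff₀ hε] at h0
  linarith

end RiemannianEigen

/-! ### Rayleigh quotients and the limit of the first eigenvalue. -/

namespace RiemannianEigen

variable {n : ℕ} {M : Type*} [TopologicalSpace M]
  [ChartedSpace (EuclideanSpace ℝ (Fin n)) M] [IsManifold (𝓡 n) ∞ M]
  [MeasurableSpace M] [BorelSpace M]

theorem not_ae_eq_zero (g : Metric n M) {φ : M → ℝ} (hφ : Continuous φ) {p : M} (hp : φ p ≠ 0) :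
    ¬ (φ =ᵐ[riemannianVolume g] 0) := by
  have := isOpenPosMeasure_riemannianVolume g
  intro h
  exact hp (congrFun (Measure.eq_of_ae_eq h hφ continuous_zero) p)

variable [CompactSpace M]

/-- The constant sequence `φ` serves as the approximating sequence. This makes smooth functions
admissible in the infimum. -/
theorem isH1_gradient (g : Metric n M) {φ : M → ℝ} (hφ : ContMDiff (𝓡 n) 𝓘(ℝ, ℝ) ∞ φ) :
    IsH1 g φ (gradient g φ) := by
  have h1 : (fun x => φ x - φ x) = (0 : M → ℝ) := by ext; simp
  have h2 : (fun x => tangentNorm g x (gradient g φ x - gradient g φ x)) = (0 : M → ℝ) := by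
    ext; simp [tangentNorm]
  refine ⟨hφ.continuous.memLp_of_hasCompactSupport (HasCompactSupport.of_compactSpace φ),
    fun _ => φ, fun _ => hφ, fun _ => ?_, fun _ => ?_, ?_, ?_⟩
  · rw [h1]; exact MemLp.zero
  · rw [h2]; exact MemLp.zero
  · simp only [h1, eLpNorm_zero, tendsto_const_nhds]
  · simp only [h2, eLpNorm_zero, tendsto_const_nhds]

theorem le_rayleigh (g : Metric n M) {a : M → ℝ} (ha : Continuous a) {m : ℝ} (hm : ∀ x, m ≤ a x)
    {ε : ℝ} (hε : 0 ≤ ε) {u : M → ℝ} {X : (x : M) → TangentSpace (𝓡 n) x} (hu : IsH1 g u X)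
    (hne : ¬ (u =ᵐ[riemannianVolume g] 0)) : m ≤ rayleigh g a ε u X := by
  have hu2 : Integrable (fun x => u x ^ 2) (riemannianVolume g) := hu.1.integrable_sq
  have hpos : 0 < ∫ x, u x ^ 2 ∂(riemannianVolume g) := by
    refine lt_of_le_of_ne (integral_nonneg fun x => sq_nonneg _) fun h0 => hne ?_
    have := (integral_eq_zero_iff_of_nonneg (fun x => sq_nonneg (u x)) hu2).1 h0.symm
    filter_upwards [this] with x hx
    simpa using hx
  obtain ⟨C, hC⟩ := (isCompact_range ha).isBounded.exists_norm_le
  have hau : Integrable (fun x => a x * u x ^ 2) (riemannianVolume g) :=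
    hu2.bdd_mul ha.aestronglyMeasurable (c := C)
      (Eventually.of_forall fun x => hC _ (Set.mem_range_self x))
  have h1 : m * ∫ x, u x ^ 2 ∂(riemannianVolume g) ≤
      ∫ x, a x * u x ^ 2 ∂(riemannianVolume g) := by
    rw [← integral_const_mul]
    exact integral_mono (hu2.const_mul m) hau fun x =>
      mul_le_mul_of_nonneg_right (hm x) (sq_nonneg _)
  have h2 : 0 ≤ ε * ∫ x, tangentNorm g x (X x) ^ 2 ∂(riemannianVolume g) :=
    mul_nonneg hε (integral_nonneg fun x => sq_nonneg _)
  rw [rayleigh, le_div_iff₀ hpos]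
  linarith

theorem firstEigenvalue_le (g : Metric n M) {a : M → ℝ} (ha : Continuous a) {m : ℝ}
    (hm : ∀ x, m ≤ a x) {ε : ℝ} (hε : 0 ≤ ε) {u : M → ℝ} {X : (x : M) → TangentSpace (𝓡 n) x}
    (hu : IsH1 g u X) (hne : ¬ (u =ᵐ[riemannianVolume g] 0)) :
    firstEigenvalue g a ε ≤ rayleigh g a ε u X := by
  refine csInf_le ⟨m, ?_⟩ ⟨u, X, hu, hne, rfl⟩
  rintro _ ⟨v, Y, hv, hv0, rfl⟩
  exact le_rayleigh g ha hm hε hv hv0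

theorem le_firstEigenvalue [Nonempty M] (g : Metric n M) {a : M → ℝ} (ha : Continuous a) {m : ℝ}
    (hm : ∀ x, m ≤ a x) {ε : ℝ} (hε : 0 ≤ ε) : m ≤ firstEigenvalue g a ε := by
  refine le_csInf ?_ ?_
  · have p : M := Classical.arbitrary M
    exact ⟨_, fun _ => 1, _, isH1_gradient g contMDiff_const,
      not_ae_eq_zero g continuous_const (p := p) one_ne_zero, rfl⟩
  · rintro _ ⟨v, Y, hv, hv0, rfl⟩
    exact le_rayleigh g ha hm hε hv hv0

/-- Concentrating a test function near a point bounds the first eigenvalue by the value of the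
potential there, up to an error which is small with `ε`. -/
theorem exists_firstEigenvalue_le [T2Space M] (g : Metric n M) {a : M → ℝ} (ha : Continuous a)
    (p : M) {b : ℝ} (hb : a p < b) :
    ∃ C : ℝ, ∀ ε > 0, firstEigenvalue g a ε ≤ ε * C + b := by
  obtain ⟨m, hm⟩ := (isCompact_range ha).bddBelow
  have hU : IsOpen {x | a x < b} := isOpen_lt ha continuous_const
  -- A smooth function whose nonvanishing set is exactly `{a < b}`: then `a φ² ≤ b φ²` everywhere,
  -- and `φ p ≠ 0`.
  obtain ⟨φ, hφs, hφ, -⟩ := hU.exists_contMDiff_support_eq (𝓡 n)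
  have hφc : Continuous φ := hφ.continuous
  have hp : φ p ≠ 0 := by
    have : p ∈ Function.support φ := hφs ▸ hb
    exact this
  have hne := not_ae_eq_zero g hφc hp
  have hφ2 : Integrable (fun x => φ x ^ 2) (riemannianVolume g) :=
    integrable_riemannianVolume g (by fun_prop)
  have hpos : 0 < ∫ x, φ x ^ 2 ∂(riemannianVolume g) := by
    have := isOpenPosMeasure_riemannianVolume g
    exact (hφc.pow 2).integral_pos_of_hasCompactSupport_nonneg_nonzero
      (HasCompactSupport.of_compactSpace _) (fun x => sq_nonneg _) (pow_ne_zero 2 hp)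
  have h1 : ∫ x, a x * φ x ^ 2 ∂(riemannianVolume g) ≤
      b * ∫ x, φ x ^ 2 ∂(riemannianVolume g) := by
    rw [← integral_const_mul]
    refine integral_mono (integrable_riemannianVolume g (by fun_prop)) (hφ2.const_mul b) fun x => ?_
    by_cases hx : φ x = 0
    · simp [hx]
    · have : x ∈ {x | a x < b} := hφs ▸ hx
      exact mul_le_mul_of_nonneg_right (le_of_lt this) (sq_nonneg _)
  refine ⟨(∫ x, tangentNorm g x (gradient g φ x) ^ 2 ∂(riemannianVolume g)) /
    ∫ x, φ x ^ 2 ∂(riemannianVolume g), fun ε hε => ?_⟩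
  refine (firstEigenvalue_le g ha (fun x => hm (Set.mem_range_self x)) hε.le
    (isH1_gradient g hφ) hne).trans ?_
  rw [rayleigh, add_div, mul_div_assoc]
  gcongr
  rwa [div_le_iff₀ hpos]

theorem tendsto_firstEigenvalue [T2Space M] (g : Metric n M) {a : M → ℝ} (ha : Continuous a)
    {p : M} (hp : ∀ x, a p ≤ a x) :
    Tendsto (fun ε : ℝ => firstEigenvalue g a ε) (𝓝[>] 0) (𝓝 (a p)) := by
  have : Nonempty M := ⟨p⟩
  rw [tendsto_order]
  constructor
  · intro b hb
    filter_upwards [self_mem_nhdsWithin] with ε hε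
    exact hb.trans_le (le_firstEigenvalue g ha hp (le_of_lt hε))
  · intro b hb
    -- The midpoint leaves room below `b` to absorb the term `ε * C`.
    obtain ⟨C, hC⟩ := exists_firstEigenvalue_le g ha p (b := (a p + b) / 2) (by linarith)
    have h0 : Tendsto (fun ε : ℝ => ε * C + (a p + b) / 2) (𝓝[>] 0) (𝓝 (0 * C + (a p + b) / 2)) :=
      Tendsto.mono_left (Continuous.tendsto (by fun_prop) 0) nhdsWithin_le_nhds
    filter_upwards [self_mem_nhdsWithin, h0.eventually_lt_const (u := b) (by linarith)] with ε hε h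
    exact (hC ε hε).trans_lt h

/-! ### The normalized measures and their weak limits. -/

theorem integral_sq_pos [Nonempty M] (g : Metric n M) {u : M → ℝ} (hu : Continuous u)
    (hpos : ∀ x, 0 < u x) : 0 < ∫ x, u x ^ 2 ∂(riemannianVolume g) := by
  have := isOpenPosMeasure_riemannianVolume g
  exact (hu.pow 2).integral_pos_of_hasCompactSupport_nonneg_nonzero
    (HasCompactSupport.of_compactSpace _) (fun x => sq_nonneg _)
    (pow_ne_zero 2 (hpos (Classical.arbitrary M)).ne')

theorem lintegral_sq_eq (g : Metric n M) {u : M → ℝ} (hu : Continuous u) :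
    ∫⁻ x, ENNReal.ofReal (u x ^ 2) ∂(riemannianVolume g) =
      ENNReal.ofReal (∫ x, u x ^ 2 ∂(riemannianVolume g)) :=
  (ofReal_integral_eq_lintegral_ofReal (integrable_riemannianVolume g (by fun_prop))
    (Eventually.of_forall fun x => sq_nonneg _)).symm

theorem isProbabilityMeasure_normalizedMeasure [Nonempty M] (g : Metric n M) {u : M → ℝ}
    (hu : Continuous u) (hpos : ∀ x, 0 < u x) :
    IsProbabilityMeasure (normalizedMeasure g u) := by
  refine ⟨?_⟩
  rw [normalizedMeasure, Measure.smul_apply, withDensity_apply _ MeasurableSet.univ,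
    Measure.restrict_univ, lintegral_sq_eq g hu, smul_eq_mul]
  exact ENNReal.inv_mul_cancel (by simpa using integral_sq_pos g hu hpos) ENNReal.ofReal_ne_top

theorem integral_normalizedMeasure (g : Metric n M) {u : M → ℝ} (hu : Continuous u) (f : M → ℝ) :
    ∫ x, f x ∂(normalizedMeasure g u) =
      (∫ x, f x * u x ^ 2 ∂(riemannianVolume g)) / ∫ x, u x ^ 2 ∂(riemannianVolume g) := by
  rw [normalizedMeasure, integral_smul_measure, lintegral_sq_eq g hu,
    integral_withDensity_eq_integral_toReal_smul
      (by have := hu.measurable; fun_prop) (by simp), ENNReal.toReal_inv,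
    ENNReal.toReal_ofReal (integral_nonneg fun x => sq_nonneg _), smul_eq_mul, div_eq_inv_mul]
  congr 1
  refine integral_congr_ae (Eventually.of_forall fun x => ?_)
  simp [ENNReal.toReal_ofReal (sq_nonneg (u x)), mul_comm]

/-- A probability measure for which the mean of `a` is its minimum is carried by the minimum
points of `a`. -/
theorem exists_eq_sum_dirac {Y : Type*} [TopologicalSpace Y] [T1Space Y] [CompactSpace Y]
    [MeasurableSpace Y] [BorelSpace Y] {a : Y → ℝ} (ha : Continuous a) {m : ℝ}
    (hm : ∀ x, m ≤ a x) {P : Finset Y} (hP : ∀ x, a x = m → x ∈ P) (ν : Measure Y)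
    [IsProbabilityMeasure ν] (hν : ∫ x, a x ∂ν = m) :
    ∃ c : Y → ℝ, ∑ p ∈ P, c p ^ 2 = 1 ∧
      ν = ∑ p ∈ P, ENNReal.ofReal (c p ^ 2) • Measure.dirac p := by
  have hai : Integrable a ν :=
    ha.integrable_of_hasCompactSupport (HasCompactSupport.of_compactSpace a)
  have h0 : ∫ x, (a x - m) ∂ν = 0 := by
    rw [integral_sub hai (integrable_const m), hν]
    simp
  have h1 := (integral_eq_zero_iff_of_nonneg (fun x => sub_nonneg.2 (hm x))
    (hai.sub (integrable_const m))).1 h0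
  have hPc : ν (P : Set Y)ᶜ = 0 := by
    refine measure_mono_null (fun x hx => ?_) h1
    intro h
    exact hx (hP x (sub_eq_zero.1 h))
  -- The coefficient at `p` is the square root of the mass of `{p}`, so that its square restores the
  -- mass.
  have hsq : ∀ p, √(ν.real {p}) ^ 2 = ν.real {p} := fun p => Real.sq_sqrt measureReal_nonneg
  have hmeas : ∀ S : Set Y, MeasurableSet S →
      ν S = (∑ p ∈ P, ENNReal.ofReal (√(ν.real {p}) ^ 2) • Measure.dirac p) S := by
    classical
    intro S hS
    -- Since the complement of `P` is null, only the points of `P` lying in `S` contribute.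
    have e1 : ν S = ν ((P.filter (· ∈ S) : Finset Y) : Set Y) := by
      rw [← measure_inter_add_sdiff S P.measurableSet,
        measure_mono_null (s := S \ P) (fun x hx => hx.2) hPc, add_zero]
      congr 1
      ext x
      simp [and_comm]
    rw [e1, ← sum_measure_singleton, Finset.sum_filter, Measure.finsetSum_apply]
    refine Finset.sum_congr rfl fun p _ => ?_
    rw [Measure.smul_apply, Measure.dirac_apply' _ hS, hsq, smul_eq_mul,
      ofReal_measureReal]
    by_cases h : p ∈ S <;> simp [h]
  refine ⟨fun p => √(ν.real {p}), ?_, Measure.ext hmeas⟩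
  simp only [hsq]
  rw [sum_measureReal_singleton, measureReal_def,
    (prob_compl_eq_zero_iff P.measurableSet).1 hPc, ENNReal.toReal_one]

end RiemannianEigen

theorem theorem1 {n : ℕ} {M : Type*} [TopologicalSpace M]
    [ChartedSpace (EuclideanSpace ℝ (Fin n)) M] [IsManifold (𝓡 n) ∞ M]
    [T2Space M] [CompactSpace M] [Nonempty M] [MeasurableSpace M] [BorelSpace M]
    (g : RiemannianEigen.Metric n M) (a : M → ℝ)
    (ha : ContMDiff (𝓡 n) 𝓘(ℝ, ℝ) 2 a) (ha_pos : ∀ x, 0 < a x)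
    (P : Finset M) (hP : ∀ x, x ∈ P ↔ ∀ y, a x ≤ a y)
    (hP_nondeg : ∀ p ∈ P, RiemannianEigen.IsNondegenerateCriticalPoint (n := n) a p) :
    Tendsto (fun ε : ℝ => RiemannianEigen.firstEigenvalue g a ε) (𝓝[>] 0) (𝓝 (⨅ x, a x)) ∧
    ∀ u : ℝ → M → ℝ,
      (∀ ε > 0, RiemannianEigen.IsPositiveEigenfunction g a ε (u ε)) →
      (∀ ε > 0, IsProbabilityMeasure (RiemannianEigen.normalizedMeasure g (u ε))) ∧
      ∀ μ : ℝ → ProbabilityMeasure M,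
        (∀ ε > 0, (μ ε : Measure M) = RiemannianEigen.normalizedMeasure g (u ε)) →
        ∀ ν : ProbabilityMeasure M, MapClusterPt ν (𝓝[>] 0) μ →
          ∃ c : M → ℝ, ∑ p ∈ P, c p ^ 2 = 1 ∧
            (ν : Measure M) = ∑ p ∈ P, ENNReal.ofReal (c p ^ 2) • Measure.dirac p := by
  have hac : Continuous a := ha.continuous
  obtain ⟨p, hp⟩ : ∃ p, ∀ x, a p ≤ a x := by
    obtain ⟨p, -, hp⟩ := isCompact_univ.exists_isMinOn Set.univ_nonempty hac.continuousOn
    exact ⟨p, fun x => hp (Set.mem_univ x)⟩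
  have hinf : ⨅ x, a x = a p :=
    le_antisymm (ciInf_le ⟨a p, Set.forall_mem_range.2 hp⟩ p) (le_ciInf hp)
  have hlim := RiemannianEigen.tendsto_firstEigenvalue g hac hp
  refine ⟨hinf ▸ hlim, fun u hu => ⟨fun ε hε =>
    RiemannianEigen.isProbabilityMeasure_normalizedMeasure g (hu ε hε).1.continuous (hu ε hε).2.1,
    fun μ hμ ν hν => ?_⟩⟩
  have hmean : Tendsto (fun ε => ∫ x, a x ∂(μ ε : Measure M)) (𝓝[>] 0) (𝓝 (a p)) := by
    refine tendsto_of_tendsto_of_tendsto_of_le_of_le' tendsto_const_nhds hlim ?_ ?_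
    -- The lower bound needs only that `μ ε` is a probability measure, so it holds for every real
    -- `ε`; the upper bound uses the equation and therefore `ε > 0`.
    · refine Eventually.of_forall fun ε => ?_
      have hai : Integrable a (μ ε : Measure M) :=
        hac.integrable_of_hasCompactSupport (HasCompactSupport.of_compactSpace a)
      simpa using integral_mono (integrable_const (a p)) hai hp
    · filter_upwards [self_mem_nhdsWithin] with ε hε
      obtain ⟨h2, hpos, heq⟩ := hu ε hε
      rw [hμ ε hε, RiemannianEigen.integral_normalizedMeasure g h2.continuous,
        div_le_iff₀ (RiemannianEigen.integral_sq_pos g h2.continuous hpos)]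
      exact RiemannianEigen.integral_potential_mul_sq_le g hac hε h2 heq
  -- On a compact space `a` is a bounded continuous function, so integration against it is weakly
  -- continuous and carries cluster points to cluster points.
  have hcl : MapClusterPt (∫ x, a x ∂(ν : Measure M)) (𝓝[>] 0)
      (fun ε => ∫ x, a x ∂(μ ε : Measure M)) :=
    hν.continuousAt_comp (ProbabilityMeasure.continuous_integral_boundedContinuousFunction
      (BoundedContinuousFunction.mkOfCompact ⟨a, hac⟩)).continuousAt
  have hval : ∫ x, a x ∂(ν : Measure M) = a p := by
    -- A cluster point of a convergent family in a Hausdorff space is its limit.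
    have h : (𝓝 (∫ x, a x ∂(ν : Measure M)) ⊓ 𝓝 (a p)).NeBot :=
      NeBot.mono hcl (inf_le_inf_left _ hmean)
    exact eq_of_nhds_neBot h
  exact RiemannianEigen.exists_eq_sum_dirac hac hp
    (fun x hx => (hP x).2 fun y => hx ▸ hp y) (ν : Measure M) hval
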